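/- Let $n\ge 2$, let $U\subseteq\mathbb R^{n+1}$ be open and $\alpha\in(0,1]$. Let $T$ be an $n$-dimensional area-minimizing current in $U$ such that $T$ and $\partial T$ are integer multiplicity rectifiable. For a point $x$, a *local decomposition of $\partial T$ at $x$* consists of a radius $\rho>0$ with $B_\rho(x)\subseteq U$, an orthogonal map $Q$ of $\mathbb R^{n+1}$, positive integers $m_1,\dots,m_N$, and functions $\varphi_\ell,\psi_\ell\in C^{1,\alpha}(B^{n-1}_\rho(0))$ $(1\le \ell\le N)$ vanishing at $0$ together with their first derivatives, such that, with $F_\ell(z)=x+Q(z,\varphi_\ell(z),\psi_\ell(z))$ for $z\in B^{n-1}_\rho(0)\subset\mathbb R^{n-1}$ (the *sheets*), $$\partial T\llcorner B_\rho(x)=(-1)^n\sum_{\ell=1}^N m_\ell\,\big[F_{\ell\#}(\mathbf E^{n-1}\llcorner B_\rho^{n-1}(0))\big]\llcorner B_\rho(x),$$ where $\mathbf E^{n-1}$ is integration of $(n-1)$-forms over $\mathbb R^{n-1}$ with its standard orientation. Suppose $T$ has $C^{1,\alpha}$ tangentially immersed boundary, i.e. $\partial T$ has a local decomposition at every point of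 $\operatorname{spt}\partial T$. A point $y\in\operatorname{spt}\partial T$ is *regular* if, for some $r>0$ with $B_r(y)\subseteq U$, some positive integer $\theta$ and some orientable embedded $C^1$ submanifold $M$ of dimension $n-1$, relatively closed in $B_r(y)$, $\partial T\llcorner B_r(y)=\theta[\![M]\!]$ for some orientation of $M$. Write $\operatorname{reg}\partial T$ for the set of regular points and $\operatorname{sing}\partial T=\operatorname{spt}\partial T\setminus\operatorname{reg}\partial T$. A point $p$ is *half-regular* if there are a point $x'\in\operatorname{sing}\partial T$, a local decomposition of $\partial T$ at $x'$ with radius $\rho$ and sheets $F_1,\dots,F_N$, a point $z\in B^{n-1}_\rho(0)$, a radius $\sigma\in(0,\rho-|z|]$ and a non-empty set $\mathcal N\subseteq\{1,\dots,N\}$ such that (i) $F_\ell(B^{n-1}_\sigma(z))\subset\operatorname{reg}\partial T$ for every $\ell\in\mathcal N$; (ii) $F_\ell(B^{n-1}_\sigma(z))\cap F_{\tilde\ell}(B^{n-1}_\sigma(z))=\emptyset$ for some $\ell,\tilde\ell\in\mathcal N$; (iii) $p\in\bigcap_{\ell\in\mathcal N}F_\ell\big(\partial B^{n-1}_\sigma(z)\cap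 B^{n-1}_\rho(0)\big)$. Let $x\in\operatorname{sing}\partial T$. Then: (a) for every local decomposition of $\partial T$ at $x$ and every $\delta>0$ there are $z,\sigma,\mathcal N$ and $p$ as above, for this decomposition (with $x'=x$), such that (i), (ii), (iii) hold and moreover $p\in\operatorname{sing}\partial T$ and $|p-x|<\delta$; (b) in particular, for every $\delta>0$ there is a half-regular point $p\in\operatorname{sing}\partial T$ with $|p-x|<\delta$. -/

import Mathlib

open Set Filter Topology MeasureTheory TopologicalSpace
open scoped NNReal ENNReal Distributions

namespace GMT

noncomputable section

/-- Euclidean space `ℝ^d`. -/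
abbrev Eu (d : ℕ) := EuclideanSpace ℝ (Fin d)

/-- Alternating `k`-forms on `ℝ^d`; the operator norm of such a form is its comass. -/
abbrev KForm (d k : ℕ) := Eu d [⋀^Fin k]→L[ℝ] ℝ

/-- A `k`-dimensional current in the open set `U ⊆ ℝ^d`: a continuous linear functional on the
space of smooth `k`-forms with compact support in `U` (with its usual LF topology). -/
abbrev Current {d : ℕ} (k : ℕ) (U : Opens (Eu d)) := 𝓓(U, KForm d k) →L[ℝ] ℝ

/-- The exterior derivative of compactly supported smooth forms. -/
def dForm {d : ℕ} (k : ℕ) (U : Opens (Eu d)) : 𝓓(U, KForm d k) →L[ℝ] 𝓓(U, KForm d (k + 1)) :=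
  (TestFunction.postcompCLM (ContinuousAlternatingMap.alternatizeUncurryFinCLM ℝ (Eu d) ℝ)).comp
    (TestFunction.fderivCLM ℝ ⊤ ⊤)

theorem dForm_apply {d : ℕ} (k : ℕ) (U : Opens (Eu d)) (ω : 𝓓(U, KForm d k)) (y : Eu d) :
    dForm k U ω y = extDeriv (fun v => ω v) y := by
  simp [dForm, extDeriv, ContinuousAlternatingMap.alternatizeUncurryFinCLM_apply]

/-- The boundary `(∂T)(ω) = T(dω)`. -/
def boundary {d k : ℕ} {U : Opens (Eu d)} (T : Current (k + 1) U) : Current k U :=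
  T.comp (dForm k U)

/-- The mass `μ_T(V)` in an open set `V`: the supremum of `T(ω)` over the forms `ω` supported in `V`
with `|ω| ≤ 1`. -/
def massOn {d k : ℕ} {U : Opens (Eu d)} (T : Current k U) (V : Set (Eu d)) : ℝ≥0∞ :=
  ⨆ (ω : 𝓓(U, KForm d k)) (_ : tsupport ω ⊆ V) (_ : ∀ y, ‖ω y‖ ≤ 1), ENNReal.ofReal (T ω)

/-- The support of `T` in `U`, that is, the support of its mass measure. -/
def spt {d k : ℕ} {U : Opens (Eu d)} (T : Current k U) : Set (Eu d) :=
  {x | x ∈ U ∧ ∀ V : Set (Eu d), IsOpen V → x ∈ V → 0 < massOn T V}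

/-! ### Integer multiplicity rectifiable currents -/

/-- `M` is countably `k`-rectifiable: up to an `ℋ^k`-null set it is covered by countably many
Lipschitz images of `ℝ^k`. -/
def CountablyRectifiable {d : ℕ} (k : ℕ) (M : Set (Eu d)) : Prop :=
  ∃ (M₀ : Set (Eu d)) (F : ℕ → Eu k → Eu d),
    (μHE[k] : Measure (Eu d)) M₀ = 0 ∧ (∀ j, ∃ L : ℝ≥0, LipschitzWith L (F j)) ∧
      M ⊆ M₀ ∪ ⋃ j, range (F j)

/-- The `k`-dimensional subspace `P` is the approximate tangent space at `x` of `M` with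
multiplicity `θ`: the blow-ups of `θ ℋ^k ⌞ M` at `x` converge weakly to `θ(x) ℋ^k ⌞ P`. -/
def HasApproxTangentSpace {d : ℕ} (k : ℕ) (M : Set (Eu d)) (θ : Eu d → ℕ) (x : Eu d)
    (P : Submodule ℝ (Eu d)) : Prop :=
  Module.finrank ℝ P = k ∧
    ∀ f : Eu d → ℝ, Continuous f → HasCompactSupport f →
      Tendsto
        (fun t : ℝ => (t ^ k)⁻¹ * ∫ y in M, f (t⁻¹ • (y - x)) * (θ y : ℝ) ∂(μHE[k] : Measure (Eu d)))
        (𝓝[>] 0)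
        (𝓝 ((θ x : ℝ) * ∫ v in (P : Set (Eu d)), f v ∂(μHE[k] : Measure (Eu d))))

/-- `T` is an integer multiplicity rectifiable current:
`T(ω) = ∫_M ⟨ω, ξ⟩ θ dℋ^k` with `M ⊆ U` an `ℋ^k`-measurable countably `k`-rectifiable set, `θ` a
positive integer valued function on `M`, locally `ℋ^k`-integrable in `U`, and `ξ` an
`ℋ^k`-measurable `k`-vector field, `ξ = τ₁ ∧ ⋯ ∧ τ_k` with `τ₁, …, τ_k` an orthonormal basis of the
approximate tangent space almost everywhere on `M`. Here `⟨ω, ξ⟩ = ω(τ₁, …, τ_k)`. -/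
def IsRectifiableCurrent {d k : ℕ} {U : Opens (Eu d)} (T : Current k U) : Prop :=
  ∃ (M : Set (Eu d)) (θ : Eu d → ℕ) (τ : Eu d → Fin k → Eu d),
    M ⊆ U ∧ NullMeasurableSet M (μHE[k] : Measure (Eu d)) ∧ CountablyRectifiable k M ∧
    (∀ y ∈ M, 0 < θ y) ∧
    (∀ K : Set (Eu d), IsCompact K → K ⊆ U →
      IntegrableOn (fun y => (θ y : ℝ)) (M ∩ K) (μHE[k] : Measure (Eu d))) ∧
    (∀ η : KForm d k,
      AEStronglyMeasurable (fun y => η (τ y)) ((μHE[k] : Measure (Eu d)).restrict M)) ∧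
    (∀ᵐ y ∂((μHE[k] : Measure (Eu d)).restrict M),
      Orthonormal ℝ (τ y) ∧ HasApproxTangentSpace k M θ y (Submodule.span ℝ (range (τ y)))) ∧
    ∀ ω : 𝓓(U, KForm d k),
      T ω = ∫ y in M, (θ y : ℝ) * ω y (τ y) ∂(μHE[k] : Measure (Eu d))

/-- The class `I_{k+1,loc}(U)`: both `T` and `∂T` are integer multiplicity rectifiable. -/
def IsIntegralCurrent {d k : ℕ} {U : Opens (Eu d)} (T : Current (k + 1) U) : Prop :=
  IsRectifiableCurrent T ∧ IsRectifiableCurrent (boundary T)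

/-- `T` minimizes mass among the integral currents with the same boundary which differ from `T`
only inside a set `V ⊂⊂ U`. -/
def IsAreaMinimizing {d k : ℕ} {U : Opens (Eu d)} (T : Current (k + 1) U) : Prop :=
  ∀ V : Set (Eu d), IsOpen V → IsCompact (closure V) → closure V ⊆ U →
    ∀ R : Current (k + 1) U, IsIntegralCurrent R → boundary R = boundary T →
      spt (T - R) ⊆ V → massOn T V ≤ massOn R V

/-! ### Integration over parametrized pieces; regular and singular points -/

/-- The value on `ω` of the push-forward `g_#(E^k ⌞ W)`, that is `∫_W g^*ω`. -/
def integralOver {d k : ℕ} (g : Eu k → Eu d) (W : Set (Eu k)) (ω : Eu d → KForm d k) : ℝ :=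
  ∫ z in W, ω (g z) (fun i => fderiv ℝ g z (EuclideanSpace.single i (1 : ℝ)))

/-- `g` is a `C^1` parametrization, defined on the open set `W ⊆ ℝ^k`, of the part of `M` in the open
set `V`: an immersion that is a homeomorphism from `W` onto `M ∩ V`. -/
structure IsC1Param {d k : ℕ} (M V : Set (Eu d)) (W : Set (Eu k)) (g : Eu k → Eu d) : Prop where
  isOpen_source : IsOpen W
  isOpen_target : IsOpen V
  contDiffOn : ContDiffOn ℝ 1 g W
  immersion : ∀ w ∈ W, Function.Injective (fderiv ℝ g w)
  embedding : IsEmbedding (W.domRestrict g)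
  image_eq : g '' W = M ∩ V

/-- A family `(V i, W i, g i)` of `C^1` parametrizations which makes `M` an oriented embedded `C^1`
submanifold, closed relative to the open set `B`: the `V i ⊆ B` cover `M` and at each common point the
change of parameters has positive Jacobian determinant. -/
structure IsOrientedSubmanifold {d k : ℕ} (B M : Set (Eu d)) {ι : Type} (V : ι → Set (Eu d))
    (W : ι → Set (Eu k)) (g : ι → Eu k → Eu d) : Prop where
  subset : M ⊆ B
  closed : closure M ∩ B ⊆ M
  param : ∀ i, IsC1Param M (V i) (W i) (g i)
  target_subset : ∀ i, V i ⊆ B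
  cover : M ⊆ ⋃ i, V i
  oriented : ∀ i j, ∀ w ∈ W i, ∀ w' ∈ W j, g i w = g j w' →
    ∃ A : Eu k →L[ℝ] Eu k, fderiv ℝ (g j) w' ∘L A = fderiv ℝ (g i) w ∧
      0 < LinearMap.det (A : Eu k →ₗ[ℝ] Eu k)

/-- `S ⌞ B = θ ⟦M⟧` for an orientable `k`-dimensional embedded `C^1` submanifold `M` of the open set
`B`, with some orientation. The current `⟦M⟧` is integration of forms over `M`: it vanishes
on forms supported away from `M`, and on forms supported in the domain of a positively oriented
parametrization it is the integral of the pull-back (by a partition of unity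
these values determine the current in `B`). -/
def EqMultipleOfSubmanifold {d k : ℕ} {U : Opens (Eu d)} (S : Current k U) (B : Set (Eu d))
    (θ : ℕ) (M : Set (Eu d)) : Prop :=
  ∃ (ι : Type) (V : ι → Set (Eu d)) (W : ι → Set (Eu k)) (g : ι → Eu k → Eu d),
    IsOrientedSubmanifold B M V W g ∧
    (∀ i, ∀ ω : 𝓓(U, KForm d k), tsupport ω ⊆ V i → S ω = (θ : ℝ) * integralOver (g i) (W i) ω) ∧
    (∀ ω : 𝓓(U, KForm d k), tsupport ω ⊆ B \ M → S ω = 0)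

/-- The regular set: points of the support near which the current is a positive
integer multiple of an embedded orientable `C^1` submanifold. -/
def reg {d k : ℕ} {U : Opens (Eu d)} (S : Current k U) : Set (Eu d) :=
  {x | x ∈ spt S ∧ ∃ ρ : ℝ, 0 < ρ ∧ Metric.ball x ρ ⊆ U ∧
    ∃ (θ : ℕ) (M : Set (Eu d)), 0 < θ ∧ EqMultipleOfSubmanifold S (Metric.ball x ρ) θ M}

/-- The singular set. -/
def sing {d k : ℕ} {U : Opens (Eu d)} (S : Current k U) : Set (Eu d) := spt S \ reg S

/-! ### Tangentially immersed boundaries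

The current `T` has dimension `n = k + 1` in `ℝ^(n+1) = ℝ^(k+2)`, and `∂T` has dimension `k`. -/

/-- `f` is of class `C^{r,α}` on the open set `s`: it is `C^r` and its `r`-th derivative is locally
`α`-Hölder continuous in `s`. -/
def IsCrα {k : ℕ} (r : ℕ) (α : ℝ≥0) (f : Eu k → ℝ) (s : Set (Eu k)) : Prop :=
  ContDiffOn ℝ r f s ∧
    ∀ y ∈ s, ∃ V ∈ 𝓝 y, ∃ C : ℝ≥0, HolderOnWith C α (iteratedFDeriv ℝ r f) (s ∩ V)

/-- The graph map `z ↦ (z, φ z, ψ z)` from `ℝ^k` to `ℝ^(k+2)`. -/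
def graphMap {k : ℕ} (φ ψ : Eu k → ℝ) (z : Eu k) : Eu (k + 2) :=
  WithLp.toLp 2 (Fin.append (fun i => z i) ![φ z, ψ z])

/-- The data of a local decomposition into `N` sheets with multiplicities: a radius `ρ`, an
orthogonal map `Q`, positive integers `m ℓ`, and `C^{r,α}` functions `φ ℓ`, `ψ ℓ` on the ball
`B_ρ(0) ⊆ ℝ^k` that vanish to first order at the origin. -/
structure Sheets (k r : ℕ) (α : ℝ≥0) where
  ρ : ℝ
  ρ_pos : 0 < ρ
  Q : Eu (k + 2) ≃ₗᵢ[ℝ] Eu (k + 2)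
  N : ℕ
  m : Fin N → ℕ
  m_pos : ∀ ℓ, 0 < m ℓ
  φ : Fin N → Eu k → ℝ
  ψ : Fin N → Eu k → ℝ
  φ_reg : ∀ ℓ, IsCrα r α (φ ℓ) (Metric.ball 0 ρ)
  ψ_reg : ∀ ℓ, IsCrα r α (ψ ℓ) (Metric.ball 0 ρ)
  φ_zero : ∀ ℓ, φ ℓ 0 = 0
  ψ_zero : ∀ ℓ, ψ ℓ 0 = 0
  dφ_zero : ∀ ℓ, fderiv ℝ (φ ℓ) 0 = 0
  dψ_zero : ∀ ℓ, fderiv ℝ (ψ ℓ) 0 = 0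

/-- The `ℓ`-th sheet at `x`: the map `z ↦ x + Q (z, φ z, ψ z)`. -/
def Sheets.sheet {k r : ℕ} {α : ℝ≥0} (D : Sheets k r α) (x : Eu (k + 2)) (ℓ : Fin D.N)
    (z : Eu k) : Eu (k + 2) :=
  x + D.Q (graphMap (D.φ ℓ) (D.ψ ℓ) z)

/-- In the ball `B_ρ(x)` the current `∂T` equals `(-1)^n ∑ m_ℓ [sheet ℓ]`, where `n = k + 1` and
`[sheet ℓ]` is the push-forward of integration over `B_ρ(0) ⊆ ℝ^k`. The restrictions of two
currents to the open ball agree iff they agree on forms with compact support in it. -/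
def Sheets.Represents {k r : ℕ} {α : ℝ≥0} (D : Sheets k r α) {U : Opens (Eu (k + 2))}
    (T : Current (k + 1) U) (x : Eu (k + 2)) : Prop :=
  Metric.ball x D.ρ ⊆ U ∧
    ∀ ω : 𝓓(U, KForm (k + 2) k), tsupport ω ⊆ Metric.ball x D.ρ →
      boundary T ω =
        (-1 : ℝ) ^ (k + 1) * ∑ ℓ, (D.m ℓ : ℝ) * integralOver (D.sheet x ℓ) (Metric.ball 0 D.ρ) ω

/-- The class of area-minimizing `T ∈ I_{k+1,loc}(U)` whose boundary is locally
`C^{r,α}` tangentially immersed. -/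
def HasTangentiallyImmersedBoundary {k : ℕ} (r : ℕ) (α : ℝ≥0) {U : Opens (Eu (k + 2))}
    (T : Current (k + 1) U) : Prop :=
  IsIntegralCurrent T ∧ IsAreaMinimizing T ∧
    ∀ x ∈ spt (boundary T), ∃ D : Sheets k r α, D.Represents T x

/-! ### Half-regular points -/

/-- The common points of the images of the sphere `∂B_σ(z)` under the sheets with index in `I`
(the sheets being defined on `B_ρ(0)` only). -/
def Sheets.commonPoints {k r : ℕ} {α : ℝ≥0} (D : Sheets k r α) (x : Eu (k + 2)) (z : Eu k) (σ : ℝ)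
    (I : Finset (Fin D.N)) : Set (Eu (k + 2)) :=
  ⋂ ℓ ∈ I, D.sheet x ℓ '' (Metric.sphere z σ ∩ Metric.ball 0 D.ρ)

/-- `z`, `σ` and the set `I` of sheet indices are as in the definition of half-regular points. -/
structure Sheets.IsHalfRegularTriple {k r : ℕ} {α : ℝ≥0} (D : Sheets k r α)
    {U : Opens (Eu (k + 2))} (T : Current (k + 1) U) (x : Eu (k + 2)) (z : Eu k) (σ : ℝ)
    (I : Finset (Fin D.N)) : Prop where
  center_mem : z ∈ Metric.ball (0 : Eu k) D.ρ
  radius_pos : 0 < σ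
  radius_le : σ ≤ D.ρ - ‖z‖
  index_nonempty : I.Nonempty
  regular : ∀ ℓ ∈ I, D.sheet x ℓ '' Metric.ball z σ ⊆ reg (boundary T)
  disjoint : ∃ ℓ ∈ I, ∃ ℓ' ∈ I,
    Disjoint (D.sheet x ℓ '' Metric.ball z σ) (D.sheet x ℓ' '' Metric.ball z σ)
  common : (D.commonPoints x z σ I).Nonempty

/-- `p` is a half-regular point of `∂T`. -/
def IsHalfRegular {k : ℕ} (α : ℝ≥0) {U : Opens (Eu (k + 2))} (T : Current (k + 1) U)
    (p : Eu (k + 2)) : Prop :=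
  ∃ x ∈ sing (boundary T), ∃ D : Sheets k 1 α, D.Represents T x ∧
    ∃ (z : Eu k) (σ : ℝ) (I : Finset (Fin D.N)),
      D.IsHalfRegularTriple T x z σ I ∧ p ∈ D.commonPoints x z σ I

end

end GMT

open GMT

/-!
The statement reduces to point-set topology of the sheets `F ℓ`, seen as graphs over a common plane.
Call a parameter `z` *unbranched* for `ℓ` if every sheet through `F ℓ z` coincides with `F ℓ` near
`z`, and a *branch point* otherwise. Close to the centre of a decomposition, `F ℓ z` is a regular
point of `∂T` if and only if `z` is unbranched for `ℓ`:

* All sheets have the same orientation, so that nothing cancels and they all lie in the support: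
  the volume form of the plane of parameters is positive on each of them
  (`Sheets.Represents.sheet_mem_spt`).
* If `F ℓ z` is regular, the sheets through it lie in one embedded `C^1` submanifold of their own
  dimension. Lifting them to a chart shows that the chart projects diffeomorphically to the plane of
  parameters, so that these graphs coincide (`IsC1Param.eventuallyEq_of_section`).
* If `z` is unbranched, then near `F ℓ z` the boundary is a positive multiple of the single sheet
  `F ℓ`, up to the sign `(-1)^(k+1)`, which a reflection of the parameters absorbs
  (`Sheets.Represents.sheet_mem_reg`).

Since the centre `x` is singular, the sheets branch at the origin. Among the branch points near the
origin take one, `a`, with the least number of sheets through its image, and let `I` be the set of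
these sheets. Near `a` no other sheet meets those in `I`, the sheets in `I` are not all equal, and
generic parameters are unbranched. So there is an unbranched `z` near `a` at which two sheets in `I`
differ. The largest ball about `z` without branch points of sheets in `I` has such a branch point
`z'` on its boundary. By minimality all sheets in `I` meet over `z'`. The two sheets that differ at
`z` are disjoint over the ball, because two sheets coincide on an open and closed subset of it. This
is `exists_ball_unbranched`.
-/

namespace GMT

/-! ### Branch points of finite families of maps -/

section Topological

variable {ι X Y : Type*} [Fintype ι] [TopologicalSpace X] [TopologicalSpace Y]

/-- The parameters at which the member `F ℓ` of a family of maps does not branch: every member that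
takes the same value there coincides with `F ℓ` nearby. -/
def unbranched (F : ι → X → Y) (ℓ : ι) : Set X :=
  {z | ∀ ℓ', F ℓ' z = F ℓ z → F ℓ' =ᶠ[𝓝 z] F ℓ}

theorem isOpen_inter_unbranched [T2Space Y] {F : ι → X → Y} {B : Set X} (hB : IsOpen B)
    (hF : ∀ ℓ, ContinuousOn (F ℓ) B) (ℓ : ι) : IsOpen (B ∩ unbranched F ℓ) := by
  refine isOpen_iff_mem_nhds.2 fun z ⟨hzB, hz⟩ => inter_mem (hB.mem_nhds hzB) ?_
  have hc : ∀ ℓ', ContinuousAt (F ℓ') z := fun ℓ' => (hF ℓ').continuousAt (hB.mem_nhds hzB)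
  have h : ∀ ℓ', ∀ᶠ w in 𝓝 z, F ℓ' w = F ℓ w → F ℓ' =ᶠ[𝓝 w] F ℓ := by
    intro ℓ'
    by_cases he : F ℓ' z = F ℓ z
    · filter_upwards [(hz ℓ' he).eventuallyEq_nhds] with w hw _ using hw
    · filter_upwards [(hc ℓ').ne_iff_eventually_ne (hc ℓ) |>.1 he] with w hw h using absurd h hw
  exact eventually_all.2 h

/-- Generic parameters are unbranched: minimize the number of coinciding pairs. -/
theorem exists_mem_forall_unbranched [T2Space Y] {F : ι → X → Y} {O : Set X} (hO : IsOpen O)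
    (hne : O.Nonempty) (hF : ∀ ℓ, ContinuousOn (F ℓ) O) :
    ∃ z ∈ O, ∀ ℓ, z ∈ unbranched F ℓ := by
  classical
  let c : X → Finset (ι × ι) := fun z => {q | F q.1 z = F q.2 z}
  obtain ⟨z, hzO, hmin⟩ := exists_minimalFor_of_wellFoundedLT (· ∈ O) (fun z => (c z).card) hne
  refine ⟨z, hzO, fun ℓ ℓ' he => ?_⟩
  have hc : ∀ ℓ', ContinuousAt (F ℓ') z := fun ℓ' => (hF ℓ').continuousAt (hO.mem_nhds hzO)
  have hsub : ∀ᶠ w in 𝓝 z, c w ⊆ c z := by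
    have : ∀ q : ι × ι, ∀ᶠ w in 𝓝 z, F q.1 w = F q.2 w → F q.1 z = F q.2 z := by
      intro q
      by_cases hq : F q.1 z = F q.2 z
      · exact Eventually.of_forall fun _ _ => hq
      · filter_upwards [(hc q.1).ne_iff_eventually_ne (hc q.2) |>.1 hq] with w hw h
          using absurd h hw
    filter_upwards [eventually_all.2 this] with w hw q hq
    simp only [c, Finset.mem_filter, Finset.mem_univ, true_and] at hq ⊢
    exact hw q hq
  filter_upwards [hsub, hO.mem_nhds hzO] with w hw hwO
  have : c w = c z := Finset.eq_of_subset_of_card_le hw (hmin hwO (Finset.card_le_card hw))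
  have hm : (ℓ', ℓ) ∈ c z := by simpa [c] using he
  rw [← this] at hm
  simpa [c] using hm

end Topological

/-- Finitely many continuous maps that branch at the origin have, arbitrarily close to it, a ball on
which a subfamily is unbranched, does not consist of one map only, but meets in a branch point over
the boundary of the ball. -/
theorem exists_ball_unbranched {ι E Y : Type*} [Fintype ι] [NormedAddCommGroup E]
    [NormedSpace ℝ E] [ProperSpace E] [TopologicalSpace Y] [T2Space Y] {F : ι → E → Y} {ε : ℝ}
    (hε : 0 < ε) (hF : ∀ ℓ, ContinuousOn (F ℓ) (Metric.ball 0 ε)) {ℓ₀ : ι}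
    (h₀ : (0 : E) ∉ unbranched F ℓ₀) :
    ∃ (z : E) (σ : ℝ) (I : Finset ι) (z' : E) (ℓ₁ : ι), 0 < σ ∧ ‖z‖ + σ < ε ∧ ℓ₁ ∈ I ∧
      (∀ ℓ ∈ I, Metric.ball z σ ⊆ unbranched F ℓ) ∧
      (∃ ℓ ∈ I, ∃ ℓ' ∈ I, ∀ w ∈ Metric.ball z σ, F ℓ w ≠ F ℓ' w) ∧
      z' ∈ Metric.sphere z σ ∧ z' ∉ unbranched F ℓ₁ ∧ ∀ ℓ ∈ I, F ℓ z' = F ℓ₁ z' := by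
  classical
  let J : E × ι → Finset ι := fun q => {ℓ | F ℓ q.1 = F q.2 q.1}
  -- a branch point with the least number of members of the family through it
  obtain ⟨⟨a, m⟩, ⟨haB, ham⟩, hmin⟩ := exists_minimalFor_of_wellFoundedLT
    (fun q : E × ι => q.1 ∈ Metric.ball 0 ε ∧ q.1 ∉ unbranched F q.2) (fun q => (J q).card)
    ⟨(0, ℓ₀), Metric.mem_ball_self hε, h₀⟩
  simp only at haB ham
  set I := J (a, m) with hI
  have hmemI : ∀ ℓ, ℓ ∈ I ↔ F ℓ a = F m a := fun ℓ => by simp [hI, J]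
  have hcon : ∀ w ∈ Metric.ball (0 : E) ε, ∀ ℓ, ContinuousAt (F ℓ) w := fun w hw ℓ =>
    (hF ℓ).continuousAt (Metric.isOpen_ball.mem_nhds hw)
  -- near `a` the members outside `I` stay away from those in `I`
  have hsep : ∀ᶠ w in 𝓝 a, ∀ ℓ ∈ I, ∀ ℓ', F ℓ' w = F ℓ w → ℓ' ∈ I := by
    refine (Filter.eventually_all_finset I).2 fun ℓ hℓ => eventually_all.2 fun ℓ' => ?_
    by_cases h : ℓ' ∈ I
    · exact Eventually.of_forall fun _ _ => h
    · have : F ℓ' a ≠ F ℓ a := fun he => h ((hmemI _).2 (he.trans ((hmemI _).1 hℓ)))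
      filter_upwards [(hcon a haB ℓ').ne_iff_eventually_ne (hcon a haB ℓ) |>.1 this] with w hw he
        using absurd he hw
  obtain ⟨r₀, hr₀, hr₀s⟩ := Metric.eventually_nhds_iff_ball.1 hsep
  have haε : ‖a‖ < ε := by simpa using haB
  obtain ⟨r, hr, hrr₀, hrε⟩ : ∃ r, 0 < r ∧ r ≤ r₀ ∧ r ≤ ε - ‖a‖ :=
    ⟨min r₀ (ε - ‖a‖), lt_min hr₀ (by linarith), min_le_left _ _, min_le_right _ _⟩
  have hball : Metric.ball a r ⊆ Metric.ball 0 ε :=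
    Metric.ball_subset_ball' (by rw [dist_zero_right]; linarith)
  obtain ⟨m', hm', hfreq⟩ : ∃ m', F m' a = F m a ∧ ∃ᶠ w in 𝓝 a, F m' w ≠ F m w := by
    simp only [unbranched, mem_ofPred_eq, not_forall] at ham
    obtain ⟨m', h, h'⟩ := ham
    exact ⟨m', h, fun h'' => h' (h''.mono fun _ hw => not_not.1 hw)⟩
  have hm'I : m' ∈ I := (hmemI _).2 hm'
  have hmI : m ∈ I := (hmemI _).2 rfl
  -- an unbranched parameter `z` close to `a` at which `F m` and `F m'` differ
  obtain ⟨z, ⟨hza, hzne⟩, hzu⟩ : ∃ z ∈ {w ∈ Metric.ball a (r / 4) | F m' w ≠ F m w},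
      ∀ ℓ, z ∈ unbranched F ℓ := by
    have hsub : Metric.ball a (r / 4) ⊆ Metric.ball 0 ε :=
      (Metric.ball_subset_ball (by linarith)).trans hball
    refine exists_mem_forall_unbranched ?_ ?_ ?_
    · refine isOpen_iff_mem_nhds.2 fun w ⟨hw, hne⟩ =>
        inter_mem (Metric.isOpen_ball.mem_nhds hw) ?_
      exact (hcon w (hsub hw) m').ne_iff_eventually_ne (hcon w (hsub hw) m) |>.1 hne
    · obtain ⟨w, hw, hw'⟩ :=
        (hfreq.and_eventually (Metric.ball_mem_nhds a (by positivity : 0 < r / 4))).exists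
      exact ⟨w, hw', hw⟩
    · exact fun ℓ => (hF ℓ).mono fun w hw => hsub hw.1
  -- the closed set of branch points of members of `I`
  set K : Set E := Metric.closedBall a (r / 2) \ ⋂ ℓ ∈ I, unbranched F ℓ with hK
  have hcb : Metric.closedBall a (r / 2) ⊆ Metric.ball a r :=
    Metric.closedBall_subset_ball (by linarith)
  have hKc : IsCompact K := by
    have h1 : IsOpen (⋂ ℓ ∈ I, (Metric.ball 0 ε ∩ unbranched F ℓ)) :=
      isOpen_biInter_finset fun ℓ _ => isOpen_inter_unbranched Metric.isOpen_ball hF ℓ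
    have h2 : K = Metric.closedBall a (r / 2) \ ⋂ ℓ ∈ I, (Metric.ball 0 ε ∩ unbranched F ℓ) := by
      ext w
      simp only [hK, Set.mem_sdiff, mem_iInter, mem_inter_iff]
      refine and_congr_right fun hw => not_congr ⟨fun h ℓ hℓ => ⟨hball (hcb hw), h ℓ hℓ⟩,
        fun h ℓ hℓ => (h ℓ hℓ).2⟩
    rw [h2]
    exact (isCompact_closedBall a (r / 2)).diff h1
  have haK : a ∈ K := ⟨Metric.mem_closedBall_self (by linarith), fun h =>
    ham (mem_iInter₂.1 h m hmI)⟩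
  obtain ⟨z', hz'K, hz'⟩ := hKc.exists_infDist_eq_dist ⟨a, haK⟩ z
  have hzK : z ∉ K := fun h => h.2 (mem_iInter₂.2 fun ℓ _ => hzu ℓ)
  have hσ : 0 < dist z z' := dist_pos.2 fun h => hzK (h ▸ hz'K)
  have hza' : dist z a < r / 4 := hza
  have hσa : dist z z' ≤ dist z a := hz' ▸ Metric.infDist_le_dist_of_mem haK
  have hzn : ‖z‖ ≤ ‖a‖ + dist z a := by
    rw [dist_eq_norm]
    simpa using norm_add_le a (z - a)
  have hz'r : z' ∈ Metric.ball a r := hcb hz'K.1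
  have hballu : ∀ ℓ ∈ I, Metric.ball z (dist z z') ⊆ unbranched F ℓ := by
    intro ℓ hℓ w hw
    by_contra hwu
    have hw' : dist w z < dist z z' := hw
    have hwK : w ∈ K := by
      refine ⟨?_, fun h => hwu (mem_iInter₂.1 h ℓ hℓ)⟩
      rw [Metric.mem_closedBall]
      linarith [dist_triangle w z a]
    have := Metric.infDist_le_dist_of_mem (x := z) hwK
    rw [hz', dist_comm z w] at this
    linarith
  obtain ⟨ℓ₁, hℓ₁, hz'u⟩ : ∃ ℓ₁ ∈ I, z' ∉ unbranched F ℓ₁ := by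
    have := hz'K.2
    simp only [mem_iInter, not_forall] at this
    obtain ⟨ℓ, h, h'⟩ := this
    exact ⟨ℓ, h, h'⟩
  have hJI : J (z', ℓ₁) ⊆ I := fun ℓ hℓ =>
    hr₀s z' (Metric.ball_subset_ball hrr₀ hz'r) ℓ₁ hℓ₁ ℓ (by simpa [J] using hℓ)
  have hJeq : J (z', ℓ₁) = I := Finset.eq_of_subset_of_card_le hJI
    (hmin (j := (z', ℓ₁)) ⟨hball hz'r, hz'u⟩ (Finset.card_le_card hJI))
  refine ⟨z, dist z z', I, z', ℓ₁, hσ, by linarith, hℓ₁, hballu, ⟨m', hm'I, m, hmI, ?_⟩,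
    by rw [Metric.mem_sphere, dist_comm], hz'u, fun ℓ hℓ => ?_⟩
  · -- on a connected unbranched set two members coincide everywhere or nowhere
    have hsub : Metric.ball z (dist z z') ⊆ Metric.ball 0 ε :=
      Metric.ball_subset_ball' (by rw [dist_zero_right]; linarith)
    have hconn : IsPreconnected (Metric.ball z (dist z z')) := (convex_ball _ _).isPreconnected
    intro w hw heq
    have hu : IsOpen {v ∈ Metric.ball z (dist z z') | F m' v ≠ F m v} :=
      isOpen_iff_mem_nhds.2 fun v ⟨hv, hne⟩ => inter_mem (Metric.isOpen_ball.mem_nhds hv)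
        ((hcon v (hsub hv) m').ne_iff_eventually_ne (hcon v (hsub hv) m) |>.1 hne)
    have hv : IsOpen {v ∈ Metric.ball z (dist z z') | F m' v = F m v} :=
      isOpen_iff_mem_nhds.2 fun v ⟨hv, he⟩ => inter_mem (Metric.isOpen_ball.mem_nhds hv)
        (hballu m hmI hv m' he)
    obtain ⟨v, -, hv1, hv2⟩ := hconn _ _ hu hv
      (fun v hv => (em (F m' v = F m v)).symm.imp (fun h => ⟨hv, h⟩) (fun h => ⟨hv, h⟩))
      ⟨z, Metric.mem_ball_self hσ, Metric.mem_ball_self hσ, hzne⟩ ⟨w, hw, hw, heq⟩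
    exact hv1.2 hv2.2
  · rw [← hJeq] at hℓ
    simpa [J] using hℓ

/-! ### The geometry of sheets -/

/-- The projection of `ℝ^(k+2)` onto its first `k` coordinates. -/
noncomputable def dropLastTwo (k : ℕ) : Eu (k + 2) →L[ℝ] Eu k :=
  LinearMap.toContinuousLinearMap
    { toFun := fun y => WithLp.toLp 2 fun i => y (Fin.castAdd 2 i)
      map_add' := fun _ _ => rfl
      map_smul' := fun _ _ => rfl }

theorem dropLastTwo_graphMap {k : ℕ} (φ ψ : Eu k → ℝ) (z : Eu k) :
    dropLastTwo k (graphMap φ ψ z) = z := by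
  ext i
  exact Fin.append_left _ _ i

theorem norm_dropLastTwo_le {k : ℕ} (y : Eu (k + 2)) : ‖dropLastTwo k y‖ ≤ ‖y‖ := by
  refine le_of_sq_le_sq ?_ (norm_nonneg y)
  rw [EuclideanSpace.norm_sq_eq, EuclideanSpace.norm_sq_eq, Fin.sum_univ_add]
  exact le_add_of_nonneg_right (Finset.sum_nonneg fun _ _ => sq_nonneg _)

namespace Sheets

variable {k r : ℕ} {α : ℝ≥0} (D : Sheets k r α)

/-- The linear projection of `ℝ^(k+2)` onto the plane of parameters of the sheets. -/
noncomputable def proj : Eu (k + 2) →L[ℝ] Eu k :=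
  (dropLastTwo k).comp (D.Q.symm.toContinuousLinearEquiv : Eu (k + 2) →L[ℝ] Eu (k + 2))

theorem proj_sheet (x : Eu (k + 2)) (ℓ : Fin D.N) (z : Eu k) :
    D.proj (D.sheet x ℓ z) = z + D.proj x := by
  rw [sheet, map_add, add_comm]
  simp [proj, dropLastTwo_graphMap]

theorem norm_proj_le (y : Eu (k + 2)) : ‖D.proj y‖ ≤ ‖y‖ :=
  (norm_dropLastTwo_le _).trans_eq (D.Q.symm.norm_map y)

theorem dist_le_dist_sheet (x : Eu (k + 2)) (ℓ ℓ' : Fin D.N) (z w : Eu k) :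
    dist z w ≤ dist (D.sheet x ℓ z) (D.sheet x ℓ' w) := by
  have h := D.norm_proj_le (D.sheet x ℓ z - D.sheet x ℓ' w)
  rwa [map_sub, proj_sheet, proj_sheet, add_sub_add_right_eq_sub, ← dist_eq_norm,
    ← dist_eq_norm] at h

theorem eq_of_sheet_eq {x : Eu (k + 2)} {ℓ ℓ' : Fin D.N} {z w : Eu k}
    (h : D.sheet x ℓ z = D.sheet x ℓ' w) : z = w :=
  dist_le_zero.1 ((D.dist_le_dist_sheet x ℓ ℓ' z w).trans_eq (dist_eq_zero.2 h))

theorem sheet_zero (x : Eu (k + 2)) (ℓ : Fin D.N) : D.sheet x ℓ 0 = x := by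
  have : graphMap (D.φ ℓ) (D.ψ ℓ) 0 = 0 := by
    ext i
    refine Fin.addCases (fun i => ?_) (fun i => ?_) i
    · simp [graphMap]
    · fin_cases i <;> simp [graphMap, D.φ_zero, D.ψ_zero]
  rw [sheet, this, map_zero, add_zero]

theorem contDiffOn_sheet (x : Eu (k + 2)) (ℓ : Fin D.N) :
    ContDiffOn ℝ r (D.sheet x ℓ) (Metric.ball 0 D.ρ) := by
  have h : ContDiffOn ℝ r (graphMap (D.φ ℓ) (D.ψ ℓ)) (Metric.ball 0 D.ρ) := by
    refine (contDiffOn_euclidean (n := (r : WithTop ℕ∞))).2 fun i => ?_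
    refine Fin.addCases (fun i => ?_) (fun i => ?_) i
    · simp only [graphMap, Fin.append_left]
      exact (EuclideanSpace.proj (𝕜 := ℝ) i).contDiff.contDiffOn
    · simp only [graphMap, Fin.append_right]
      fin_cases i
      · exact (D.φ_reg ℓ).1
      · exact (D.ψ_reg ℓ).1
  exact contDiffOn_const.add (D.Q.toContinuousLinearEquiv.contDiff.comp_contDiffOn h)

end Sheets

/-! ### Sheets inside a submanifold -/

/-- A map that stays in the image of a `C^1` parametrization lifts continuously to the
parameters. -/
theorem IsC1Param.exists_lift {d k : ℕ} {M V : Set (Eu d)} {W : Set (Eu k)} {g : Eu k → Eu d}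
    (hg : IsC1Param M V W g) {X : Type*} [TopologicalSpace X] {F : X → Eu d} {z : X}
    (hF : ContinuousAt F z) (hM : ∀ᶠ w in 𝓝 z, F w ∈ M) (hz : F z ∈ V) :
    ∃ h : X → Eu k, ContinuousAt h z ∧ h z ∈ W ∧ ∀ᶠ w in 𝓝 z, g (h w) = F w := by
  classical
  have hMV : ∀ᶠ w in 𝓝 z, F w ∈ g '' W := by
    rw [hg.image_eq]
    exact hM.and (hF.eventually_mem (hg.isOpen_target.mem_nhds hz))
  obtain ⟨a, ha, -⟩ := hMV.self_of_nhds
  have hex : ∀ w, ∃ b : W, F w ∈ g '' W → g b = F w := by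
    intro w
    by_cases h : F w ∈ g '' W
    · obtain ⟨b, hb, hbw⟩ := h
      exact ⟨⟨b, hb⟩, fun _ => hbw⟩
    · exact ⟨⟨a, ha⟩, fun h' => absurd h' h⟩
  choose h hh using hex
  have hev : W.domRestrict g ∘ h =ᶠ[𝓝 z] F := hMV.mono hh
  have hc : ContinuousAt h z := by
    rw [hg.embedding.isInducing.continuousAt_iff]
    exact hF.congr hev.symm
  exact ⟨fun w => h w, continuous_subtype_val.continuousAt.comp hc, (h z).2, hev⟩

/-- If `g` is an immersion at `h z` and `g ∘ h` is a differentiable section of the linear map `P`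
up to a translation, then `P ∘ g` is injective near `h z`. By dimension count the derivative of
`P ∘ g` is invertible. -/
theorem exists_injOn_of_section {E F : Type*} [NormedAddCommGroup E] [NormedSpace ℝ E]
    [FiniteDimensional ℝ E] [NormedAddCommGroup F] [NormedSpace ℝ F] [FiniteDimensional ℝ F]
    {P : F →L[ℝ] E} {g : E → F} {G : E → F} {h : E → E} {z c : E}
    (hg : ContDiffAt ℝ 1 g (h z)) (hinj : Function.Injective (fderiv ℝ g (h z)))
    (hG : DifferentiableAt ℝ G z) (hP : ∀ w, P (G w) = w + c) (hh : ContinuousAt h z)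
    (hgh : ∀ᶠ w in 𝓝 z, g (h w) = G w) : ∃ s ∈ 𝓝 (h z), InjOn (fun w => P (g w)) s := by
  have hgs : HasStrictFDerivAt g (fderiv ℝ g (h z)) (h z) := hg.hasStrictFDerivAt one_ne_zero
  obtain ⟨L, hL⟩ := LinearMap.exists_leftInverse_of_injective
    (fderiv ℝ g (h z) : E →ₗ[ℝ] F) (LinearMap.ker_eq_bot.2 hinj)
  have hhd := HasFDerivAt.of_comp_of_leftInverse hh hgs.hasFDerivAt hG.hasFDerivAt hgh
    (f'symm := LinearMap.toContinuousLinearMap L) (fun v => DFunLike.congr_fun hL v)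
  set h' := LinearMap.toContinuousLinearMap L ∘L fderiv ℝ G z
  set A := P ∘L fderiv ℝ g (h z)
  have h1 : HasFDerivAt (fun w => P (g (h w))) (A ∘L h') z :=
    (P.hasFDerivAt.comp (h z) hgs.hasFDerivAt).comp z hhd
  have h2 : HasFDerivAt (fun w => P (g (h w))) (ContinuousLinearMap.id ℝ E) z := by
    refine ((hasFDerivAt_id z).add_const c).congr_of_eventuallyEq ?_
    filter_upwards [hgh] with w hw
    rw [hw, hP]; rfl
  have h3 : A ∘L h' = ContinuousLinearMap.id ℝ E := h1.unique h2
  have hsurj : Function.Surjective A := fun v => ⟨h' v, DFunLike.congr_fun h3 v⟩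
  have hAinj : Function.Injective A :=
    (LinearMap.injective_iff_surjective (f := (A : E →ₗ[ℝ] E))).2 hsurj
  let e : E ≃L[ℝ] E :=
    (LinearEquiv.ofBijective (A : E →ₗ[ℝ] E) ⟨hAinj, hsurj⟩).toContinuousLinearEquiv
  have hs : HasStrictFDerivAt (fun w => P (g w)) (e : E →L[ℝ] E) (h z) :=
    P.hasStrictFDerivAt.comp (h z) hgs
  refine ⟨_, hs.eventually_left_inverse, fun u hu v hv huv => ?_⟩
  have hu' : hs.localInverse _ _ _ (P (g u)) = u := hu
  have hv' : hs.localInverse _ _ _ (P (g v)) = v := hv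
  rw [← hu', ← hv']
  exact congrArg _ huv

/-- Two graphs over the same plane through a common point of an embedded `C^1` submanifold, of the
same dimension and both contained in it, coincide near this point. -/
theorem IsC1Param.eventuallyEq_of_section {d k : ℕ} {M V : Set (Eu d)} {W : Set (Eu k)}
    {g : Eu k → Eu d} (hg : IsC1Param M V W g) {P : Eu d →L[ℝ] Eu k} {F G : Eu k → Eu d}
    {z c : Eu k} (hF : DifferentiableAt ℝ F z) (hG : DifferentiableAt ℝ G z)
    (hPF : ∀ w, P (F w) = w + c) (hPG : ∀ w, P (G w) = w + c) (hFM : ∀ᶠ w in 𝓝 z, F w ∈ M)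
    (hGM : ∀ᶠ w in 𝓝 z, G w ∈ M) (hFG : F z = G z) (hz : F z ∈ V) : F =ᶠ[𝓝 z] G := by
  obtain ⟨a, hac, haW, ha⟩ := hg.exists_lift hF.continuousAt hFM hz
  obtain ⟨b, hbc, hbW, hb⟩ := hg.exists_lift hG.continuousAt hGM (hFG ▸ hz)
  have hab : a z = b z := by
    have h : g (a z) = g (b z) := by rw [ha.self_of_nhds, hb.self_of_nhds, hFG]
    exact congrArg Subtype.val
      (hg.embedding.injective (a₁ := (⟨a z, haW⟩ : W)) (a₂ := ⟨b z, hbW⟩) h)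
  obtain ⟨s, hs, hinj⟩ := exists_injOn_of_section
    (hg.contDiffOn.contDiffAt (hg.isOpen_source.mem_nhds haW)) (hg.immersion _ haW) hF hPF hac ha
  filter_upwards [ha, hb, hac.eventually_mem hs, hbc.eventually_mem (hab ▸ hs)]
    with w hwa hwb has hbs
  have : a w = b w := hinj has hbs (by simp only [hwa, hwb, hPF, hPG])
  rw [← hwa, ← hwb, this]

/-! ### Regular points of the boundary are unbranched -/

/-- A current that vanishes on the forms supported in `B \ M`, where `M` is closed relative to the
open set `B`, has no support in `B` outside `M`. -/
theorem mem_of_mem_spt {d k : ℕ} {U : Opens (Eu d)} {S : Current k U} {B M : Set (Eu d)}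
    (hB : IsOpen B) (hM : closure M ∩ B ⊆ M)
    (hS : ∀ ω : 𝓓(U, KForm d k), tsupport ω ⊆ B \ M → S ω = 0) {y : Eu d} (hy : y ∈ spt S)
    (hyB : y ∈ B) : y ∈ M := by
  by_contra hyM
  have hpos := hy.2 (B \ closure M) (hB.sdiff isClosed_closure)
    ⟨hyB, fun h => hyM (hM ⟨h, hyB⟩)⟩
  refine hpos.ne' ?_
  simp only [massOn, ENNReal.iSup_eq_zero]
  intro ω hω _
  rw [hS ω (hω.trans (sdiff_subset_sdiff_right subset_closure)), ENNReal.ofReal_zero]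

/-- If two sheets contained in the support of a current meet in a regular point of it, then they
coincide near this point. -/
theorem Sheets.eventuallyEq_of_mem_reg {k : ℕ} {α : ℝ≥0} (D : Sheets k 1 α)
    {U : Opens (Eu (k + 2))} {S : Current k U} {x : Eu (k + 2)} {z : Eu k}
    (hz : z ∈ Metric.ball 0 D.ρ) {ℓ ℓ' : Fin D.N}
    (hℓ : ∀ᶠ w in 𝓝 z, D.sheet x ℓ w ∈ spt S) (hℓ' : ∀ᶠ w in 𝓝 z, D.sheet x ℓ' w ∈ spt S)
    (hreg : D.sheet x ℓ z ∈ reg S) (heq : D.sheet x ℓ z = D.sheet x ℓ' z) :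
    D.sheet x ℓ =ᶠ[𝓝 z] D.sheet x ℓ' := by
  obtain ⟨hspt, R, hR, -, θ, M, -, ι, V, W, g, hMs, -, hS⟩ := hreg
  have hd : ∀ j, DifferentiableAt ℝ (D.sheet x j) z := fun j =>
    ((D.contDiffOn_sheet x j).contDiffAt (Metric.isOpen_ball.mem_nhds hz)).differentiableAt
      (by simp)
  have hM : ∀ j, D.sheet x ℓ z = D.sheet x j z → (∀ᶠ w in 𝓝 z, D.sheet x j w ∈ spt S) →
      ∀ᶠ w in 𝓝 z, D.sheet x j w ∈ M := by
    intro j hj hjs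
    filter_upwards [hjs, (hd j).continuousAt.eventually_mem
      (by rw [← hj]; exact Metric.ball_mem_nhds _ hR)] with w hw hwB
    exact mem_of_mem_spt Metric.isOpen_ball hMs.closed hS hw hwB
  have hM1 := hM ℓ rfl hℓ
  obtain ⟨i, hi⟩ := mem_iUnion.1 (hMs.cover hM1.self_of_nhds)
  exact (hMs.param i).eventuallyEq_of_section (hd ℓ) (hd ℓ') (D.proj_sheet x ℓ) (D.proj_sheet x ℓ')
    hM1 (hM ℓ' heq hℓ') heq hi

/-! ### Sheets lie in the support -/

/-- The standard volume form of `ℝ^k`. -/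
noncomputable def stdVolume (k : ℕ) : KForm k k :=
  { (EuclideanSpace.basisFun (Fin k) ℝ).toBasis.det with
    cont := by
      refine Continuous.matrix_det (continuous_matrix fun i j => ?_)
      exact (EuclideanSpace.proj (𝕜 := ℝ) i).continuous.comp (continuous_apply j) }

theorem stdVolume_single (k : ℕ) : stdVolume k (fun i => EuclideanSpace.single i (1 : ℝ)) = 1 := by
  have h := (EuclideanSpace.basisFun (Fin k) ℝ).toBasis.det_self
  have h2 : ⇑(EuclideanSpace.basisFun (Fin k) ℝ).toBasis
      = fun i => EuclideanSpace.single i (1 : ℝ) := by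
    ext1 i; simp
  rwa [h2] at h

namespace Sheets

variable {k : ℕ} {α : ℝ≥0} (D : Sheets k 1 α)

theorem differentiableAt_sheet (x : Eu (k + 2)) (ℓ : Fin D.N) {z : Eu k}
    (hz : z ∈ Metric.ball 0 D.ρ) : DifferentiableAt ℝ (D.sheet x ℓ) z :=
  ((D.contDiffOn_sheet x ℓ).contDiffAt (Metric.isOpen_ball.mem_nhds hz)).differentiableAt
    (by simp)

theorem proj_fderiv_sheet (x : Eu (k + 2)) (ℓ : Fin D.N) {z : Eu k}
    (hz : z ∈ Metric.ball 0 D.ρ) (v : Eu k) : D.proj (fderiv ℝ (D.sheet x ℓ) z v) = v := by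
  have h1 : HasFDerivAt (fun w => D.proj (D.sheet x ℓ w)) (D.proj ∘L fderiv ℝ (D.sheet x ℓ) z) z :=
    D.proj.hasFDerivAt.comp z (D.differentiableAt_sheet x ℓ hz).hasFDerivAt
  have h2 : HasFDerivAt (fun w => D.proj (D.sheet x ℓ w)) (ContinuousLinearMap.id ℝ (Eu k)) z := by
    simp only [proj_sheet]
    exact (hasFDerivAt_id z).add_const _
  exact DFunLike.congr_fun (h1.unique h2) v

/-- The volume form of the plane of parameters, pulled back to `ℝ^(k+2)`. It pulls back to the
standard volume form under every sheet. -/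
noncomputable def planeForm : KForm (k + 2) k := (stdVolume k).compContinuousLinearMap D.proj

theorem planeForm_fderiv_sheet (x : Eu (k + 2)) (ℓ : Fin D.N) {z : Eu k}
    (hz : z ∈ Metric.ball 0 D.ρ) :
    D.planeForm (fun i => fderiv ℝ (D.sheet x ℓ) z (EuclideanSpace.single i (1 : ℝ))) = 1 := by
  rw [planeForm, ContinuousAlternatingMap.compContinuousLinearMap_apply]
  exact (congrArg (stdVolume k) (funext fun i => D.proj_fderiv_sheet x ℓ hz _)).trans
    (stdVolume_single k)

/-- There is no cancellation between the sheets, since `planeForm` is positive on all of them. -/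
theorem Represents.sheet_mem_spt {D : Sheets k 1 α} {U : Opens (Eu (k + 2))}
    {T : Current (k + 1) U} {x : Eu (k + 2)} (hD : D.Represents T x) {ℓ : Fin D.N} {z : Eu k}
    (hz : z ∈ Metric.ball 0 D.ρ) (hy : D.sheet x ℓ z ∈ Metric.ball x D.ρ) :
    D.sheet x ℓ z ∈ spt (boundary T) := by
  refine ⟨hD.1 hy, fun V hV hyV => ?_⟩
  obtain ⟨R, hR, hRV⟩ := Metric.nhds_basis_closedBall.mem_iff.1
    (inter_mem (hV.mem_nhds hyV) (Metric.isOpen_ball.mem_nhds hy))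
  let χ : ContDiffBump (D.sheet x ℓ z) := ⟨R / 2, R, half_pos hR, half_lt_self hR⟩
  -- the sign makes the value positive, the factor bounds the norm by one
  set a : ℝ := (‖D.planeForm‖ + 1)⁻¹ with ha
  have ha0 : 0 < a := by positivity
  set c : ℝ := (-1) ^ (k + 1) * a with hc
  have hsupp : tsupport (fun y => χ y • c • D.planeForm) ⊆ Metric.closedBall (D.sheet x ℓ z) R :=
    (closure_mono (Function.support_smul_subset_left _ _)).trans χ.tsupport_eq.subset
  let ω : 𝓓(U, KForm (k + 2) k) :=
    { toFun := fun y => χ y • c • D.planeForm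
      contDiff' := χ.contDiff.smul contDiff_const
      hasCompactSupport' := χ.hasCompactSupport.smul_right
      tsupport_subset' := hsupp.trans fun y hy => hD.1 (hRV hy).2 }
  have hω : ∀ y, ω y = χ y • c • D.planeForm := fun _ => rfl
  have hcabs : |c| = a := by
    rw [hc, abs_mul, abs_pow, abs_neg, abs_one, one_pow, one_mul, abs_of_pos ha0]
  have hnorm : ∀ y, ‖ω y‖ ≤ 1 := by
    intro y
    rw [hω, norm_smul, norm_smul, Real.norm_of_nonneg χ.nonneg, Real.norm_eq_abs, hcabs]
    refine mul_le_one₀ χ.le_one (by positivity) ?_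
    rw [ha, inv_mul_le_one₀ (by positivity)]
    linarith
  have hint : ∀ j, integralOver (D.sheet x j) (Metric.ball 0 D.ρ) ω
      = c * ∫ w in Metric.ball 0 D.ρ, χ (D.sheet x j w) := by
    intro j
    rw [integralOver, ← integral_const_mul]
    refine setIntegral_congr_fun measurableSet_ball fun w hw => ?_
    simp only [hω, ContinuousAlternatingMap.smul_apply, smul_eq_mul,
      D.planeForm_fderiv_sheet x j hw]
    ring
  have hval : boundary T ω
      = a * ∑ j, (D.m j : ℝ) * ∫ w in Metric.ball 0 D.ρ, χ (D.sheet x j w) := by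
    rw [hD.2 ω (hsupp.trans fun y hy => (hRV hy).2), Finset.mul_sum, Finset.mul_sum]
    refine Finset.sum_congr rfl fun j _ => ?_
    have h1 : (-1 : ℝ) ^ (k + 1) * (-1) ^ (k + 1) = 1 := by
      rw [← mul_pow]; norm_num
    rw [hint, hc]
    linear_combination (a * D.m j * ∫ w in Metric.ball 0 D.ρ, χ (D.sheet x j w)) * h1
  have hposint : 0 < ∫ w in Metric.ball 0 D.ρ, χ (D.sheet x ℓ w) := by
    have hcont : ContinuousOn (fun w => χ (D.sheet x ℓ w)) (Metric.ball 0 D.ρ) :=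
      χ.continuous.comp_continuousOn (D.contDiffOn_sheet x ℓ).continuousOn
    have hInt : IntegrableOn (fun w => χ (D.sheet x ℓ w)) (Metric.ball 0 D.ρ) :=
      IntegrableOn.of_bound measure_ball_lt_top
        (hcont.aestronglyMeasurable measurableSet_ball) 1
        (Eventually.of_forall fun w => by
          rw [Real.norm_of_nonneg χ.nonneg]; exact χ.le_one)
    rw [setIntegral_pos_iff_support_of_nonneg_ae (Eventually.of_forall fun w => χ.nonneg) hInt,
      inter_comm]
    have hopen : IsOpen (Metric.ball 0 D.ρ ∩ Function.support fun w => χ (D.sheet x ℓ w)) :=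
      hcont.isOpen_inter_preimage Metric.isOpen_ball isOpen_compl_singleton
    exact hopen.measure_pos _ ⟨z, hz, (χ.pos_of_mem_ball (Metric.mem_ball_self hR)).ne'⟩
  have hpos : 0 < boundary T ω := by
    rw [hval]
    refine mul_pos ha0 (Finset.sum_pos' (fun j _ => ?_) ⟨ℓ, Finset.mem_univ _, ?_⟩)
    · exact mul_nonneg (Nat.cast_nonneg _)
        (setIntegral_nonneg measurableSet_ball fun w _ => χ.nonneg)
    · exact mul_pos (Nat.cast_pos.2 (D.m_pos ℓ)) hposint
  refine (ENNReal.ofReal_pos.2 hpos).trans_le ?_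
  exact le_iSup_of_le ω (le_iSup_of_le (hsupp.trans fun y hy => (hRV hy).1)
    (le_iSup_of_le hnorm le_rfl))

theorem Represents.eventually_mem_spt {D : Sheets k 1 α} {U : Opens (Eu (k + 2))}
    {T : Current (k + 1) U} {x : Eu (k + 2)} (hD : D.Represents T x) {ℓ : Fin D.N} {z : Eu k}
    (hz : z ∈ Metric.ball 0 D.ρ) (hy : D.sheet x ℓ z ∈ Metric.ball x D.ρ) :
    ∀ᶠ w in 𝓝 z, D.sheet x ℓ w ∈ spt (boundary T) := by
  filter_upwards [Metric.isOpen_ball.mem_nhds hz, (D.differentiableAt_sheet x ℓ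
    hz).continuousAt.eventually_mem (Metric.isOpen_ball.mem_nhds hy)] with w hw hwy
    using hD.sheet_mem_spt hw hwy

/-- The branch points of the sheets are singular. -/
theorem Represents.sheet_mem_sing {D : Sheets k 1 α} {U : Opens (Eu (k + 2))}
    {T : Current (k + 1) U} {x : Eu (k + 2)} (hD : D.Represents T x) {ℓ : Fin D.N} {z : Eu k}
    (hz : z ∈ Metric.ball 0 D.ρ) (hy : D.sheet x ℓ z ∈ Metric.ball x D.ρ)
    (hbr : z ∉ unbranched (D.sheet x) ℓ) : D.sheet x ℓ z ∈ sing (boundary T) := by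
  refine ⟨hD.sheet_mem_spt hz hy, fun hreg => hbr fun ℓ' heq => ?_⟩
  exact (D.eventuallyEq_of_mem_reg hz (hD.eventually_mem_spt hz hy)
    (hD.eventually_mem_spt hz (heq ▸ hy)) hreg heq.symm).symm

end Sheets

/-! ### Unbranched points are regular -/

/-- In positive dimension both orientations are realized by linear isometries. -/
theorem exists_linearIsometryEquiv_det_eq {k : ℕ} (hk : 1 ≤ k) (n : ℕ) :
    ∃ A : Eu k ≃ₗᵢ[ℝ] Eu k,
      LinearMap.det (A.toLinearEquiv : Eu k →ₗ[ℝ] Eu k) = (-1) ^ n := by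
  rcases Nat.even_or_odd n with hn | hn
  · exact ⟨LinearIsometryEquiv.refl ℝ _, by rw [hn.neg_one_pow]; exact LinearMap.det_id⟩
  · let v : Eu k := EuclideanSpace.single ⟨0, hk⟩ 1
    have hv : v ≠ 0 := by simp [v]
    refine ⟨(ℝ ∙ v)ᗮ.reflection, ?_⟩
    have := Submodule.det_reflection (𝕜 := ℝ) (ℝ ∙ v)ᗮ
    rw [Submodule.orthogonal_orthogonal, finrank_span_singleton hv, pow_one] at this
    rw [hn.neg_one_pow]
    exact this

theorem KForm.apply_comp_det {d k : ℕ} (f : KForm d k) (B : Eu k →L[ℝ] Eu d)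
    (A : Eu k →ₗ[ℝ] Eu k) (e : Module.Basis (Fin k) ℝ (Eu k)) :
    f (fun i => B (A (e i))) = LinearMap.det A * f (fun i => B (e i)) := by
  have h := AlternatingMap.eq_smul_basis_det e
    (f.toAlternatingMap.compLinearMap (B : Eu k →ₗ[ℝ] Eu d))
  have h1 : f (fun i => B (A (e i))) = f (fun i => B (e i)) * e.det (A ∘ e) :=
    DFunLike.congr_fun h (A ∘ e)
  rw [h1, Module.Basis.det_comp, e.det_self, mul_one, mul_comm]

/-- The effect of a linear isometry of the parameters on the orientation. -/
theorem integralOver_comp_linearIsometryEquiv {d k : ℕ} (g : Eu k → Eu d) (W : Set (Eu k))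
    (ω : Eu d → KForm d k) (A : Eu k ≃ₗᵢ[ℝ] Eu k) :
    integralOver (g ∘ A) (A ⁻¹' W) ω
      = LinearMap.det (A.toLinearEquiv : Eu k →ₗ[ℝ] Eu k) * integralOver g W ω := by
  have hcov : ∫ w in A ⁻¹' W, ω (g (A w)) (fun i => fderiv ℝ g (A w) (EuclideanSpace.single i 1))
      = integralOver g W ω := A.measurePreserving.setIntegral_preimage_emb
    A.toHomeomorph.measurableEmbedding
    (fun v => ω (g v) fun i => fderiv ℝ g v (EuclideanSpace.single i (1 : ℝ))) W
  rw [← hcov, integralOver, ← integral_const_mul]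
  refine integral_congr_ae (Eventually.of_forall fun w => ?_)
  have h : fderiv ℝ (g ∘ A) w = (fderiv ℝ g (A w)).comp
      (A.toContinuousLinearEquiv : Eu k →L[ℝ] Eu k) :=
    A.toContinuousLinearEquiv.comp_right_fderiv
  have := KForm.apply_comp_det (ω (g (A w))) (fderiv ℝ g (A w))
    (A.toLinearEquiv : Eu k →ₗ[ℝ] Eu k) (EuclideanSpace.basisFun (Fin k) ℝ).toBasis
  simp only [OrthonormalBasis.coe_toBasis, EuclideanSpace.basisFun_apply] at this
  simp only [h]
  exact this

namespace Sheets

variable {k : ℕ} {α : ℝ≥0}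

/-- Around an unbranched parameter `z`, a small ball about `F ℓ z` meets only the sheets that
coincide with `F ℓ` near `z`. -/
theorem exists_radius_of_unbranched {D : Sheets k 1 α} {x : Eu (k + 2)} {ℓ : Fin D.N} {z : Eu k}
    (hz : z ∈ Metric.ball 0 D.ρ) (hun : z ∈ unbranched (D.sheet x) ℓ) {r : ℝ} (hr : 0 < r) :
    ∃ R, 0 < R ∧ R ≤ r ∧ Metric.ball z R ⊆ Metric.ball 0 D.ρ ∧ ∀ ℓ',
      (D.sheet x ℓ' z = D.sheet x ℓ z → ∀ w ∈ Metric.ball z R, D.sheet x ℓ' w = D.sheet x ℓ w) ∧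
      (D.sheet x ℓ' z ≠ D.sheet x ℓ z → ∀ w ∈ Metric.ball z R,
        D.sheet x ℓ' w ∉ Metric.ball (D.sheet x ℓ z) R) := by
  have key : ∀ P : Eu k → Prop, (∀ᶠ w in 𝓝 z, P w) →
      ∀ᶠ R in 𝓝[>] (0 : ℝ), ∀ w ∈ Metric.ball z R, P w := by
    intro P hP
    obtain ⟨s, hs, h⟩ := Metric.eventually_nhds_iff_ball.1 hP
    filter_upwards [Ioo_mem_nhdsGT hs] with R hR w hw
    exact h w (Metric.ball_subset_ball hR.2.le hw)
  have h1 : ∀ᶠ R in 𝓝[>] (0 : ℝ), ∀ ℓ',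
      (D.sheet x ℓ' z = D.sheet x ℓ z → ∀ w ∈ Metric.ball z R, D.sheet x ℓ' w = D.sheet x ℓ w) ∧
      (D.sheet x ℓ' z ≠ D.sheet x ℓ z → ∀ w ∈ Metric.ball z R,
        D.sheet x ℓ' w ∉ Metric.ball (D.sheet x ℓ z) R) := by
    refine eventually_all.2 fun ℓ' => ?_
    by_cases h : D.sheet x ℓ' z = D.sheet x ℓ z
    · filter_upwards [key _ (hun ℓ' h)] with R hR
      exact ⟨fun _ => hR, fun h' => absurd h h'⟩
    · set d := dist (D.sheet x ℓ' z) (D.sheet x ℓ z)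
      have hd : 0 < d := dist_pos.2 h
      filter_upwards [key _ ((D.differentiableAt_sheet x ℓ' hz).continuousAt.eventually_mem
        (Metric.ball_mem_nhds _ (half_pos hd))), Ioo_mem_nhdsGT (half_pos hd)] with R hR hRd
      refine ⟨fun h' => absurd h' h, fun _ w hw hwR => ?_⟩
      have h1 : dist (D.sheet x ℓ' w) (D.sheet x ℓ' z) < d / 2 := hR w hw
      have h2 : dist (D.sheet x ℓ' w) (D.sheet x ℓ z) < R := hwR
      linarith [dist_triangle_left (D.sheet x ℓ' z) (D.sheet x ℓ z) (D.sheet x ℓ' w), hRd.2]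
  obtain ⟨R, ⟨⟨hR, h2⟩, h3⟩, h4⟩ := ((eventually_mem_of_tendsto_nhdsWithin tendsto_id).and
    (Ioo_mem_nhdsGT hr) |>.and (key _ (Metric.isOpen_ball.mem_nhds hz)) |>.and h1).exists
  exact ⟨R, hR, h2.2.le, h3, h4⟩

/-- Near the image of an unbranched parameter, the boundary is a multiple of a single sheet, which
is reparametrized by a reflection when the sign `(-1)^(k+1)` is negative. -/
theorem Represents.sheet_mem_reg {D : Sheets k 1 α} {U : Opens (Eu (k + 2))} (hk : 1 ≤ k)
    {T : Current (k + 1) U} {x : Eu (k + 2)} (hD : D.Represents T x) {ℓ : Fin D.N} {z : Eu k}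
    (hz : z ∈ Metric.ball 0 D.ρ) (hy : D.sheet x ℓ z ∈ Metric.ball x D.ρ)
    (hun : z ∈ unbranched (D.sheet x) ℓ) : D.sheet x ℓ z ∈ reg (boundary T) := by
  classical
  obtain ⟨r, hr, hrx⟩ := Metric.isOpen_ball.mem_nhds hy |> Metric.mem_nhds_iff.1
  obtain ⟨R, hR, hRr, hRρ, hRs⟩ := exists_radius_of_unbranched hz hun hr
  set y := D.sheet x ℓ z with hy_def
  set B := Metric.ball y R with hB
  have hBx : B ⊆ Metric.ball x D.ρ := (Metric.ball_subset_ball hRr).trans hrx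
  have hnear : ∀ ℓ' w, D.sheet x ℓ' w ∈ B → w ∈ Metric.ball z R := fun ℓ' w hw =>
    (D.dist_le_dist_sheet x ℓ' ℓ w z).trans_lt hw
  set W₀ : Set (Eu k) := Metric.ball 0 D.ρ ∩ D.sheet x ℓ ⁻¹' B with hW₀
  have hW₀o : IsOpen W₀ := (D.contDiffOn_sheet x ℓ).continuousOn.isOpen_inter_preimage
    Metric.isOpen_ball Metric.isOpen_ball
  obtain ⟨A, hA⟩ := exists_linearIsometryEquiv_det_eq hk (k + 1)
  set J : Finset (Fin D.N) := {ℓ' | D.sheet x ℓ' z = y} with hJ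
  -- the value of the boundary on forms supported in the small ball
  have hval : ∀ ω : 𝓓(U, KForm (k + 2) k), tsupport ω ⊆ B → boundary T ω
      = ((∑ ℓ' ∈ J, D.m ℓ' : ℕ) : ℝ) * integralOver (D.sheet x ℓ ∘ A) (A ⁻¹' W₀) ω := by
    intro ω hω
    have hzero : ∀ {p}, p ∉ B → ω p = 0 := fun {p} hp => image_eq_zero_of_notMem_tsupport
      fun h => hp (hω h)
    have hout : ∀ ℓ' ∉ J, integralOver (D.sheet x ℓ') (Metric.ball 0 D.ρ) ω = 0 := by
      intro ℓ' hℓ'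
      refine setIntegral_eq_zero_of_forall_eq_zero fun w _ => ?_
      have hw : D.sheet x ℓ' w ∉ B := fun h =>
        (hRs ℓ').2 (by simpa [hJ] using hℓ') w (hnear ℓ' w h) h
      rw [hzero hw]; rfl
    have hin : ∀ ℓ' ∈ J, integralOver (D.sheet x ℓ') (Metric.ball 0 D.ρ) ω
        = integralOver (D.sheet x ℓ) W₀ ω := by
      intro ℓ' hℓ'
      have heq := (hRs ℓ').1 (by simpa [hJ] using hℓ')
      refine (setIntegral_eq_of_subset_of_forall_sdiff_eq_zero measurableSet_ball
        inter_subset_left fun w hw => ?_).trans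
        (setIntegral_congr_fun hW₀o.measurableSet fun w hw => ?_)
      · have hwB : D.sheet x ℓ' w ∉ B := fun h => hw.2 ⟨hw.1, by
          rw [mem_preimage, ← heq w (hnear ℓ' w h)]; exact h⟩
        rw [hzero hwB]; rfl
      · have hwR := hnear ℓ w hw.2
        have hev : D.sheet x ℓ' =ᶠ[𝓝 w] D.sheet x ℓ := by
          filter_upwards [Metric.isOpen_ball.mem_nhds hwR] with v hv using heq v hv
        simp only [hev.fderiv_eq, heq w hwR]
    rw [hD.2 ω (hω.trans hBx), integralOver_comp_linearIsometryEquiv, hA,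
      ← Finset.sum_subset (Finset.subset_univ J) fun ℓ' _ hℓ' => by rw [hout ℓ' hℓ', mul_zero],
      Finset.sum_congr rfl fun ℓ' hℓ' => by rw [hin ℓ' hℓ'], ← Finset.sum_mul, Nat.cast_sum]
    ring
  have hJpos : 0 < ∑ ℓ' ∈ J, D.m ℓ' :=
    Finset.sum_pos (fun ℓ' _ => D.m_pos ℓ') ⟨ℓ, by simp [hJ, hy_def]⟩
  have hinj : Function.Injective (D.sheet x ℓ ∘ A) := fun v w h =>
    A.injective (D.eq_of_sheet_eq h)
  have himage : D.sheet x ℓ ∘ A '' (A ⁻¹' W₀) = D.sheet x ℓ '' W₀ := by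
    rw [image_comp, image_preimage_eq _ A.surjective]
  have hcd : ContDiffOn ℝ 1 (D.sheet x ℓ ∘ A) (A ⁻¹' W₀) :=
    ((D.contDiffOn_sheet x ℓ).mono inter_subset_left).comp A.contDiff.contDiffOn
      (mapsTo_preimage _ _)
  have hMB : D.sheet x ℓ '' W₀ ⊆ B := image_subset_iff.2 fun w hw => hw.2
  have hfd : ∀ w, fderiv ℝ (D.sheet x ℓ ∘ A) w = (fderiv ℝ (D.sheet x ℓ) (A w)).comp
      (A.toContinuousLinearEquiv : Eu k →L[ℝ] Eu k) := fun w =>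
    A.toContinuousLinearEquiv.comp_right_fderiv
  have hparam : IsC1Param (D.sheet x ℓ '' W₀) B (A ⁻¹' W₀) (D.sheet x ℓ ∘ A) :=
    { isOpen_source := hW₀o.preimage A.continuous
      isOpen_target := Metric.isOpen_ball
      contDiffOn := hcd
      immersion := by
        intro w hw
        rw [hfd]
        refine Function.Injective.comp (g := fderiv ℝ (D.sheet x ℓ) (A w)) ?_ A.injective
        exact Function.LeftInverse.injective (g := D.proj) (D.proj_fderiv_sheet x ℓ hw.1)
      embedding := by
        -- the projection recovers the parameter continuously
        have hc : Continuous fun p : Eu (k + 2) => A.symm (D.proj p - D.proj x) := by fun_prop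
        refine IsEmbedding.of_comp hcd.continuousOn.domRestrict hc ?_
        convert! IsEmbedding.subtypeVal (p := (· ∈ A ⁻¹' W₀)) using 1
        ext1 w
        simp [proj_sheet]
      image_eq := by rw [himage, inter_eq_left.2 hMB] }
  refine ⟨hD.sheet_mem_spt hz hy, R, hR, hBx.trans hD.1, _, D.sheet x ℓ '' W₀, hJpos,
    Unit, fun _ => B, fun _ => A ⁻¹' W₀, fun _ => D.sheet x ℓ ∘ A, ?_, fun _ => hval, ?_⟩
  · refine ⟨hMB, ?_, fun _ => hparam, fun _ => subset_rfl, fun p hp => mem_iUnion.2 ⟨(), hMB hp⟩,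
      fun _ _ w hw w' hw' h => ⟨ContinuousLinearMap.id ℝ _, ?_, ?_⟩⟩
    · -- a limit of points of the sheet is the image of its own projection
      rintro p ⟨hp, hpB⟩
      set v := D.proj p - D.proj x with hv
      have hvz : v ∈ Metric.ball z R := by
        have h := D.norm_proj_le (p - y)
        rw [map_sub, hy_def, proj_sheet, ← dist_eq_norm, ← dist_eq_norm] at h
        rw [Metric.mem_ball, dist_eq_norm]
        refine lt_of_le_of_lt ?_ (h.trans_lt hpB)
        rw [dist_eq_norm, hv, sub_sub, add_comm z]
      have hvρ := hRρ hvz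
      have hpv : D.sheet x ℓ v = p := by
        have hcl : p ∈ closure (D.sheet x ℓ '' W₀) := hp
        obtain ⟨u, hu, hup⟩ := mem_closure_iff_seq_limit.1 hcl
        choose w hw hwu using hu
        have hwv : Tendsto w atTop (𝓝 v) := by
          have : Tendsto (fun n => D.proj (u n) - D.proj x) atTop (𝓝 v) :=
            ((D.proj.continuous.tendsto p).comp hup).sub_const _
          refine this.congr fun n => ?_
          rw [← hwu, proj_sheet, add_sub_cancel_right]
        have h1 := (D.differentiableAt_sheet x ℓ hvρ).continuousAt.tendsto.comp hwv
        exact tendsto_nhds_unique h1 (hup.congr fun n => (hwu n).symm)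
      exact ⟨v, ⟨hvρ, by rw [mem_preimage, hpv]; exact hpB⟩, hpv⟩
    · rw [hinj h, ContinuousLinearMap.comp_id]
    · rw [ContinuousLinearMap.coe_id, LinearMap.det_id]
      exact one_pos
  · intro ω hω
    rw [hval ω (hω.trans sdiff_subset)]
    refine mul_eq_zero_of_right _ (setIntegral_eq_zero_of_forall_eq_zero fun w hw => ?_)
    have : D.sheet x ℓ (A w) ∉ tsupport ω := fun h => (hω h).2 ⟨A w, hw, rfl⟩
    rw [Function.comp_apply, image_eq_zero_of_notMem_tsupport this]
    rfl

end Sheets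

/-! ### Half-regular points near a singular point -/

/-- At a singular point the sheets branch. This uses that sheets which coincide near the origin form
a multiple of one submanifold. -/
theorem Sheets.Represents.zero_notMem_unbranched {k : ℕ} {α : ℝ≥0} {D : Sheets k 1 α}
    {U : Opens (Eu (k + 2))} (hk : 1 ≤ k) {T : Current (k + 1) U} {x : Eu (k + 2)}
    (hD : D.Represents T x) (hx : x ∈ sing (boundary T)) :
    ∃ ℓ, (0 : Eu k) ∉ unbranched (D.sheet x) ℓ := by
  have h0 : (0 : Eu k) ∈ Metric.ball 0 D.ρ := Metric.mem_ball_self D.ρ_pos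
  have hxx : x ∈ Metric.ball x D.ρ := Metric.mem_ball_self D.ρ_pos
  -- without sheets the boundary would vanish near `x`
  have hN : Nonempty (Fin D.N) := by
    by_contra hN
    rw [not_nonempty_iff] at hN
    exact mem_of_mem_spt (M := ∅) Metric.isOpen_ball (by simp)
      (fun ω hω => by rw [hD.2 ω (hω.trans sdiff_subset)]; simp) hx.1 hxx
  obtain ⟨ℓ⟩ := hN
  refine ⟨ℓ, fun hun => hx.2 ?_⟩
  have := hD.sheet_mem_reg hk h0 (ℓ := ℓ) (by rwa [D.sheet_zero]) hun
  rwa [D.sheet_zero] at this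

theorem Sheets.Represents.exists_isHalfRegularTriple {k : ℕ} {α : ℝ≥0} {D : Sheets k 1 α}
    {U : Opens (Eu (k + 2))} (hk : 1 ≤ k) {T : Current (k + 1) U} {x : Eu (k + 2)}
    (hD : D.Represents T x) (hx : x ∈ sing (boundary T)) {δ : ℝ} (hδ : 0 < δ) :
    ∃ (z : Eu k) (σ : ℝ) (I : Finset (Fin D.N)), D.IsHalfRegularTriple T x z σ I ∧
      ∃ p ∈ D.commonPoints x z σ I, p ∈ sing (boundary T) ∧ dist p x < δ := by
  obtain ⟨ℓ₀, hℓ₀⟩ := hD.zero_notMem_unbranched hk hx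
  -- over a small ball the sheets stay in the ball of the decomposition and close to `x`
  obtain ⟨ε, hε, hερ, hεx⟩ : ∃ ε, 0 < ε ∧ ε ≤ D.ρ ∧ ∀ w ∈ Metric.ball (0 : Eu k) ε, ∀ ℓ,
      D.sheet x ℓ w ∈ Metric.ball x (min D.ρ δ) := by
    have h : ∀ᶠ w in 𝓝 (0 : Eu k), ∀ ℓ, D.sheet x ℓ w ∈ Metric.ball x (min D.ρ δ) := by
      refine eventually_all.2 fun ℓ => ?_
      refine (D.differentiableAt_sheet x ℓ
        (Metric.mem_ball_self D.ρ_pos)).continuousAt.eventually_mem ?_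
      rw [D.sheet_zero]
      exact Metric.ball_mem_nhds _ (lt_min D.ρ_pos hδ)
    obtain ⟨ε, hε, hεs⟩ := Metric.eventually_nhds_iff_ball.1 h
    exact ⟨min ε D.ρ, lt_min hε D.ρ_pos, min_le_right _ _, fun w hw =>
      hεs w (Metric.ball_subset_ball (min_le_left _ _) hw)⟩
  have hερ' : Metric.ball (0 : Eu k) ε ⊆ Metric.ball 0 D.ρ := Metric.ball_subset_ball hερ
  obtain ⟨z, σ, I, z', ℓ₁, hσ, hzσ, hℓ₁, hun, ⟨ℓ, hℓ, ℓ', hℓ', hne⟩, hz', hbr, hcommon⟩ :=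
    exists_ball_unbranched hε
      (fun ℓ => (D.contDiffOn_sheet x ℓ).continuousOn.mono hερ') hℓ₀
  have hcb : Metric.closedBall z σ ⊆ Metric.ball 0 ε :=
    Metric.closedBall_subset_ball' (by rw [dist_zero_right]; linarith)
  have hz'ε : z' ∈ Metric.ball 0 ε := hcb (Metric.sphere_subset_closedBall hz')
  have hin : ∀ w ∈ Metric.ball (0 : Eu k) ε, ∀ ℓ, D.sheet x ℓ w ∈ Metric.ball x D.ρ :=
    fun w hw ℓ => Metric.ball_subset_ball (min_le_left _ _) (hεx w hw ℓ)
  have hp : D.sheet x ℓ₁ z' ∈ D.commonPoints x z σ I :=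
    mem_iInter₂.2 fun j hj => ⟨z', ⟨hz', hερ' hz'ε⟩, hcommon j hj⟩
  refine ⟨z, σ, I, ⟨?_, hσ, by linarith, ⟨ℓ₁, hℓ₁⟩, ?_, ⟨ℓ, hℓ, ℓ', hℓ', ?_⟩, ⟨_, hp⟩⟩,
    _, hp, hD.sheet_mem_sing (hερ' hz'ε) (hin z' hz'ε ℓ₁) hbr,
    (Metric.ball_subset_ball (min_le_right _ _) (hεx z' hz'ε ℓ₁) :)⟩
  · exact hερ' (hcb (Metric.mem_closedBall_self hσ.le))
  · rintro j hj _ ⟨w, hw, rfl⟩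
    have hwε := hcb (Metric.ball_subset_closedBall hw)
    exact hD.sheet_mem_reg hk (hερ' hwε) (hin w hwε j) (hun j hj hw)
  · rw [Set.disjoint_left]
    rintro _ ⟨w, hw, rfl⟩ ⟨w', hw', h⟩
    obtain rfl := D.eq_of_sheet_eq h
    exact hne _ hw h.symm

end GMT

theorem mainTheorem8 (k : ℕ) (hk : 1 ≤ k) (U : Opens (Eu (k + 2))) (α : ℝ≥0) (hα0 : 0 < α)
    (hα1 : α ≤ 1) (T : Current (k + 1) U) (hT : HasTangentiallyImmersedBoundary 1 α T)
    (x : Eu (k + 2)) (hx : x ∈ sing (boundary T)) :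
    (∀ D : Sheets k 1 α, D.Represents T x → ∀ δ : ℝ, 0 < δ →
      ∃ (z : Eu k) (σ : ℝ) (I : Finset (Fin D.N)),
        D.IsHalfRegularTriple T x z σ I ∧
        ∃ p ∈ D.commonPoints x z σ I, p ∈ sing (boundary T) ∧ dist p x < δ) ∧
    (∀ δ : ℝ, 0 < δ → ∃ p, IsHalfRegular α T p ∧ p ∈ sing (boundary T) ∧ dist p x < δ) := by
  refine ⟨fun D hD δ hδ => hD.exists_isHalfRegularTriple hk hx hδ, fun δ hδ => ?_⟩
  obtain ⟨D, hD⟩ := hT.2.2 x hx.1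
  obtain ⟨z, σ, I, htriple, p, hp, hps, hpx⟩ := hD.exists_isHalfRegularTriple hk hx hδ
  exact ⟨p, ⟨x, hx, D, hD, z, σ, I, htriple, hp⟩, hps, hpx⟩
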